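/- Let $Q$ be a finite-dimensional smooth manifold, $\pi_Q:T^*Q\to Q$ its cotangent bundle and $\omega_Q=-d\theta=dq^A\wedge dp_A$ the canonical symplectic form ($\theta$ the Liouville $1$-form). Let $j_1:M_1\hookrightarrow T^*Q$ be an embedded submanifold, $\omega_1=j_1^*\omega_Q$, and let $h_1:M_1\to\mathbb R$ be a smooth function. The constraint algorithm of Gotay, Nester and Hinds for $(M_1,\omega_1,dh_1)$ produces $$M_{l+1}=\{p\in M_l \;:\; \text{there is } X_p\in T_pM_l \text{ with } \omega_1(X_p,\cdot)=dh_1(p)\text{ on }T_pM_1\}.$$ Assume that it runs through embedded submanifolds and stabilizes, $M_{k+1}=M_k=:M_f$ for some $k$; let $j_f:M_f\hookrightarrow M_1$ be the inclusion and $\omega_f=j_f^*\omega_1$. Assume that $Q_f:=\pi_Q(M_f)$ is an embedded submanifold of $Q$ and that the restriction $\pi_f:M_f\to Q_f$ of $\pi_Q$ is a (surjective) submersion. A smooth vector field $X$ on $M_f$ is called a solution of the extended equations of motion if $X=Y+Z$ with smooth vector fields $Y,Z$ on $M_f$ such that $i_Y\omega_1=dh_1$ (as covectors on $M_1$, at the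 points of $M_f$) and $Z\in\ker\omega_f$. More generally, a vector field $V$ on $M_f$ along a smooth map $\varphi:N\to M_f$ (i.e. $V(n)\in T_{\varphi(n)}M_f$) is called a solution of the extended equations along $\varphi$ if $V=Y+Z$ with smooth vector fields $Y,Z$ on $M_f$ along $\varphi$ such that $i_Y\omega_1=dh_1$ and $Z\in\ker\omega_f$ at the points $\varphi(n)$. Let $X$ be a solution of the extended equations of motion on $M_f$. Let $\gamma$ be a smooth closed $1$-form on $Q$ with $\gamma(Q)\subset M_1$ and $\gamma(Q_f)\subset M_f$, let $\gamma_f:Q_f\to M_f$ be its restriction, and let $X^\gamma=T\pi_f\circ X\circ\gamma_f$, a vector field on $Q_f$. Then $$X(\gamma_f(q))-T_q\gamma_f(X^\gamma(q))\in\ker\omega_f(\gamma_f(q))\ \text{ for all } q\in Q_f\quad\Longleftrightarrow\quad d(h_1\circ\gamma_f)=0 .$$ If $d(h_1\circ\gamma_f)=0$, then $T\gamma_f(X^\gamma)$ is again a solution of the extended equations of motion, along $\gamma_f$. -/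

import Mathlib

open scoped Manifold ContDiff Topology

noncomputable section

namespace SingularHJ

section Forms

variable {E : Type*} [NormedAddCommGroup E] [NormedSpace ℝ E]
  {H : Type*} [TopologicalSpace H]
  {E' : Type*} [NormedAddCommGroup E'] [NormedSpace ℝ E']
  {H' : Type*} [TopologicalSpace H']

/-- A (not necessarily smooth) field of covectors on a manifold `M`. -/
abbrev OneForm (I : ModelWithCorners ℝ E H) (M : Type*) [TopologicalSpace M]
    [ChartedSpace H M] : Type _ :=
  (x : M) → TangentSpace I x →L[ℝ] ℝ

/-- A (not necessarily smooth) field of bilinear forms on the tangent spaces of a manifold `M`. -/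
abbrev BilinForm (I : ModelWithCorners ℝ E H) (M : Type*) [TopologicalSpace M]
    [ChartedSpace H M] : Type _ :=
  (x : M) → TangentSpace I x →L[ℝ] TangentSpace I x →L[ℝ] ℝ

/-- The expression of the one-form `θ` in the chart `φ` at `x`, that is, `(φ⁻¹)^* θ`
(meaningful on the target of `φ`). -/
def localOneForm (I : ModelWithCorners ℝ E H) {M : Type*} [TopologicalSpace M]
    [ChartedSpace H M] (θ : OneForm I M) (x : M) (y : E) : E →L[ℝ] ℝ :=
  (θ ((extChartAt I x).symm y)).comp (mfderiv 𝓘(ℝ, E) I (extChartAt I x).symm y)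

/-- The exterior derivative of a one-form on a manifold without boundary:
`dθ (u, v) = D η (u) (v) - D η (v) (u)`, where `η` is the expression of `θ` in the chart at `x`
and `u`, `v` are read in that chart. -/
def extDerivOneForm (I : ModelWithCorners ℝ E H) [I.Boundaryless] {M : Type*}
    [TopologicalSpace M] [ChartedSpace H M] (θ : OneForm I M) : BilinForm I M :=
  fun x =>
    let D : E →L[ℝ] E →L[ℝ] ℝ := fderiv ℝ (localOneForm I θ x) (extChartAt I x x)
    let T : TangentSpace I x →L[ℝ] E := mfderiv I 𝓘(ℝ, E) (extChartAt I x) x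
    (ContinuousLinearMap.precomp ℝ T).comp ((D - D.flip).comp T)

/-- The pullback `f^* Ω` of a field of bilinear forms. -/
def pullbackForm (I : ModelWithCorners ℝ E H) (I' : ModelWithCorners ℝ E' H')
    {M : Type*} [TopologicalSpace M] [ChartedSpace H M]
    {M' : Type*} [TopologicalSpace M'] [ChartedSpace H' M']
    (f : M → M') (Ω : BilinForm I' M') : BilinForm I M :=
  fun x =>
    let T : TangentSpace I x →L[ℝ] TangentSpace I' (f x) := mfderiv I I' f x
    (ContinuousLinearMap.precomp ℝ T).comp ((Ω (f x)).comp T)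

end Forms

section Cotangent

/-- The cotangent bundle `T^*Q` of a manifold `Q` modelled on `E`, with Mathlib's manifold
structure on the total space of a bundle of continuous linear maps. -/
abbrev CotangentBundle (E : Type*) [NormedAddCommGroup E] [NormedSpace ℝ E]
    (Q : Type*) [TopologicalSpace Q] [ChartedSpace E Q] : Type _ :=
  Bundle.TotalSpace (E →L[ℝ] ℝ) (fun q : Q => TangentSpace 𝓘(ℝ, E) q →L[ℝ] ℝ)

/-- The model with corners (in fact without boundary) of `T^*Q`. -/
abbrev cotangentModel (E : Type*) [NormedAddCommGroup E] [NormedSpace ℝ E] :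
    ModelWithCorners ℝ (E × (E →L[ℝ] ℝ)) (ModelProd E (E →L[ℝ] ℝ)) :=
  𝓘(ℝ, E).prod 𝓘(ℝ, E →L[ℝ] ℝ)

variable (E : Type*) [NormedAddCommGroup E] [NormedSpace ℝ E]
  (Q : Type*) [TopologicalSpace Q] [ChartedSpace E Q]

/-- The Liouville one-form `θ = p_A dq^A` on `T^*Q`: `θ_α (W) = α (Tπ_Q W)`. -/
def liouvilleForm [IsManifold 𝓘(ℝ, E) ∞ Q] : OneForm (cotangentModel E) (CotangentBundle E Q) :=
  fun α => α.2.comp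
    (mfderiv (cotangentModel E) 𝓘(ℝ, E) (fun β : CotangentBundle E Q => β.proj) α)

/-- The canonical symplectic form `ω_Q = -dθ = dq^A ∧ dp_A` on `T^*Q`. -/
def canonicalForm [IsManifold 𝓘(ℝ, E) ∞ Q] : BilinForm (cotangentModel E) (CotangentBundle E Q) :=
  fun α => -extDerivOneForm (cotangentModel E) (liouvilleForm E Q) α

variable {E Q}

/-- A one-form on `Q` regarded as a map `Q → T^*Q`. -/
def toCotangent (γ : OneForm 𝓘(ℝ, E) Q) (q : Q) : CotangentBundle E Q := ⟨q, γ q⟩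

end Cotangent

section Algorithm

variable {F : Type*} [NormedAddCommGroup F] [NormedSpace ℝ F]
  {M : Type*} [TopologicalSpace M] [ChartedSpace F M]

/-- `S` is a smooth embedded submanifold of `M`: around each of its points there is a smooth
chart of `M` in which `S` is a slice, i.e. an affine subspace. -/
def IsEmbeddedSubmanifold (S : Set M) : Prop :=
  ∀ p ∈ S, ∃ φ ∈ IsManifold.maximalAtlas 𝓘(ℝ, F) ∞ M, p ∈ φ.source ∧
    ∃ V : Submodule ℝ F, ∀ x ∈ φ.source, x ∈ S ↔ φ x - φ p ∈ V

/-- `v` is tangent to `S` at `p`: it is the velocity at time `0` of a smooth curve in `S`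
through `p`. For an embedded submanifold `S` these vectors form the tangent space `T_p S`. -/
def IsTangentTo (S : Set M) (p : M) (v : TangentSpace 𝓘(ℝ, F) p) : Prop :=
  ∃ c : ℝ → M, ContMDiff 𝓘(ℝ, ℝ) 𝓘(ℝ, F) ∞ c ∧ (∀ t, c t ∈ S) ∧
    tangentMap 𝓘(ℝ, ℝ) 𝓘(ℝ, F) c ⟨0, (1 : ℝ)⟩ = (⟨p, v⟩ : TangentBundle 𝓘(ℝ, F) M)

/-- The constraint algorithm of Gotay, Nester and Hinds for the presymplectic system `(M, Ω, dh)`: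
it starts with all of `M`, and the next set consists of the points `p` of the present one `S`
at which `i_X Ω = dh` has a solution `X ∈ T_p S`. -/
def constraintSet (Ω : BilinForm 𝓘(ℝ, F) M) (h : M → ℝ) : ℕ → Set M
  | 0 => Set.univ
  | l + 1 => {p | p ∈ constraintSet Ω h l ∧ ∃ X : TangentSpace 𝓘(ℝ, F) p,
      IsTangentTo (constraintSet Ω h l) p X ∧ Ω p X = mvfderiv 𝓘(ℝ, F) h p}

/-- `S` is the final constraint submanifold: the algorithm runs through embedded submanifolds
and stabilizes at `S`. -/
def IsFinalConstraintSubmanifold (Ω : BilinForm 𝓘(ℝ, F) M) (h : M → ℝ) (S : Set M) : Prop :=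
  ∃ k, (∀ l ≤ k, IsEmbeddedSubmanifold (F := F) (constraintSet Ω h l)) ∧
    constraintSet Ω h (k + 1) = constraintSet Ω h k ∧ S = constraintSet Ω h k

end Algorithm

section Solutions

variable {F₁ : Type*} [NormedAddCommGroup F₁] [NormedSpace ℝ F₁]
  {M₁ : Type*} [TopologicalSpace M₁] [ChartedSpace F₁ M₁]
  {F : Type*} [NormedAddCommGroup F] [NormedSpace ℝ F]
  {M : Type*} [TopologicalSpace M] [ChartedSpace F M] [IsManifold 𝓘(ℝ, F) ∞ M]
  {G : Type*} [NormedAddCommGroup G] [NormedSpace ℝ G]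
  {N : Type*} [TopologicalSpace N] [ChartedSpace G N]

/-- `V` is a smooth vector field along the map `φ : N → M`, i.e. `V n ∈ T_{φ n} M` depends
smoothly on `n`. -/
def IsSmoothFieldAlong (φ : N → M) (V : (n : N) → TangentSpace 𝓘(ℝ, F) (φ n)) : Prop :=
  ContMDiff 𝓘(ℝ, G) 𝓘(ℝ, F).tangent ∞ (fun n => (⟨φ n, V n⟩ : TangentBundle 𝓘(ℝ, F) M))

/-- Let `j : M → M₁` be the inclusion of a submanifold. A vector field `V` on `M` along
`φ : N → M` is a solution of the extended equations of motion if `V = Y + Z` with smooth vector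
fields `Y`, `Z` (on `M`, along `φ`) such that `i_Y Ω = dh` (as covectors on `M₁`) and
`Z ∈ ker (j^* Ω)`. -/
def IsExtendedSolutionAlong (Ω : BilinForm 𝓘(ℝ, F₁) M₁) (h : M₁ → ℝ) (j : M → M₁)
    (φ : N → M) (V : (n : N) → TangentSpace 𝓘(ℝ, F) (φ n)) : Prop :=
  ∃ Y Z : (n : N) → TangentSpace 𝓘(ℝ, F) (φ n),
    IsSmoothFieldAlong (G := G) φ Y ∧ IsSmoothFieldAlong (G := G) φ Z ∧
    (∀ n, V n = Y n + Z n) ∧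
    (∀ n, Ω (j (φ n)) (mfderiv 𝓘(ℝ, F) 𝓘(ℝ, F₁) j (φ n) (Y n)) =
      mvfderiv 𝓘(ℝ, F₁) h (j (φ n))) ∧
    (∀ n, pullbackForm 𝓘(ℝ, F) 𝓘(ℝ, F₁) j Ω (φ n) (Z n) = 0)

/-- A vector field `X` on `M` is a solution of the extended equations of motion. -/
def IsExtendedSolution (Ω : BilinForm 𝓘(ℝ, F₁) M₁) (h : M₁ → ℝ) (j : M → M₁)
    (X : (m : M) → TangentSpace 𝓘(ℝ, F) m) : Prop :=
  IsExtendedSolutionAlong (G := F) Ω h j (fun m : M => m) X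

end Solutions

end SingularHJ

end

/-! At `γf q`, write P = Tπ_f and S = Tγ_f, so that P S = id. Two subspaces are isotropic for ω_f:
ker P, because Tj₁ ∘ Tj_f sends it to vertical vectors of T^*Q (`canonicalForm_apply_of_vertical`),
and im S, because γ^*ω_Q = -dγ = 0 (`pullbackForm_toCotangent_canonicalForm`). By linear algebra
(`bilin_apply_sub_section`), ω_f(X - S P X, w) = ω_f(X, S P w). Since X differs from Y by an element
of ker ω_f and i_Y ω₁ = dh₁, the right side is d(h₁ ∘ γ_f)(P w). As P is onto, the left side
vanishes for all w exactly when d(h₁ ∘ γ_f) = 0. In that case Tγ_f(X^γ), X and Y have the same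
contraction with ω_f, so Y along γ_f serves as the dynamical part of Tγ_f(X^γ). -/

namespace SingularHJ

/-! ### Canonical coordinates (q, p) on T^*Q. -/

section CotangentChart

variable {E : Type*} [NormedAddCommGroup E] [NormedSpace ℝ E]
  {Q : Type*} [TopologicalSpace Q] [ChartedSpace E Q] [IsManifold 𝓘(ℝ, E) ∞ Q]

lemma extChartAt_cotangent_fst (α β : CotangentBundle E Q) :
    (extChartAt (cotangentModel E) α β).1 = extChartAt 𝓘(ℝ, E) α.proj β.proj := by
  rw [FiberBundle.extChartAt]
  rfl

/-- The bundle chart is built from the tangent trivialization, whose inverse on fibres is the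
derivative of the inverse base chart; momenta are therefore pulled back by that derivative. -/
lemma extChartAt_cotangent_snd (α β : CotangentBundle E Q)
    (h : β.proj ∈ (chartAt E α.proj).source) :
    (extChartAt (cotangentModel E) α β).2 =
      ContinuousLinearMap.comp (β.2 : E →L[ℝ] ℝ)
        (mfderiv 𝓘(ℝ, E) 𝓘(ℝ, E) (extChartAt 𝓘(ℝ, E) α.proj).symm
          (extChartAt 𝓘(ℝ, E) α.proj β.proj) : E →L[ℝ] E) := by
  have e := TangentBundle.symmL_trivializationAt (I := 𝓘(ℝ, E)) h
  rw [modelWithCornersSelf_coe, Set.range_id, mfderivWithin_univ] at e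
  rw [FiberBundle.extChartAt]
  change ContinuousLinearMap.inCoordinates E (TangentSpace 𝓘(ℝ, E)) ℝ (Bundle.Trivial Q ℝ)
    α.proj β.proj α.proj β.proj β.2 = _
  rw [ContinuousLinearMap.inCoordinates, e]
  ext v
  simp
  rfl

lemma mem_extChartAt_cotangent_source {α β : CotangentBundle E Q} :
    β ∈ (extChartAt (cotangentModel E) α).source ↔ β.proj ∈ (chartAt E α.proj).source := by
  rw [FiberBundle.extChartAt]
  simp only [PartialEquiv.trans_source]
  simp
  exact id

end CotangentChart

/-! ### The Liouville form and its differential in canonical coordinates. -/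

section LiouvilleForm

variable {E : Type*} [NormedAddCommGroup E] [NormedSpace ℝ E]
  {Q : Type*} [TopologicalSpace Q] [ChartedSpace E Q] [IsManifold 𝓘(ℝ, E) ∞ Q]

lemma mdifferentiableAt_cotangent_proj (α : CotangentBundle E Q) :
    MDifferentiableAt (cotangentModel E) 𝓘(ℝ, E) (fun β : CotangentBundle E Q => β.proj) α :=
  (Bundle.contMDiff_proj (n := ∞) (IB := 𝓘(ℝ, E)) (F := E →L[ℝ] ℝ)
    (fun q : Q => TangentSpace 𝓘(ℝ, E) q →L[ℝ] ℝ)).mdifferentiableAt (by simp)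

lemma mdifferentiableAt_extChartAt_symm {F : Type*} [NormedAddCommGroup F] [NormedSpace ℝ F]
    {H : Type*} [TopologicalSpace H] {I : ModelWithCorners ℝ F H} [I.Boundaryless]
    {M : Type*} [TopologicalSpace M] [ChartedSpace H M] [IsManifold I 1 M] (x : M) {z : F}
    (hz : z ∈ (extChartAt I x).target) :
    MDifferentiableAt 𝓘(ℝ, F) I (extChartAt I x).symm z := by
  have := mdifferentiableWithinAt_extChartAt_symm hz
  rwa [I.range_eq_univ, mdifferentiableWithinAt_univ] at this

/-- In a chart of `T^*Q`, the Liouville form is `p_A dq^A`. -/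
lemma localOneForm_liouvilleForm (α : CotangentBundle E Q) {z : E × (E →L[ℝ] ℝ)}
    (hz : z ∈ (extChartAt (cotangentModel E) α).target) :
    localOneForm (cotangentModel E) (liouvilleForm E Q) α z =
      z.2.comp (ContinuousLinearMap.fst ℝ E (E →L[ℝ] ℝ)) := by
  have : IsManifold 𝓘(ℝ, E) 1 Q := .of_le (n := ∞) (by simp)
  have : IsManifold (cotangentModel E) 1 (CotangentBundle E Q) := .of_le (n := ∞) (by simp)
  set β := (extChartAt (cotangentModel E) α).symm z with hβ
  have hβs : β.proj ∈ (chartAt E α.proj).source :=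
    mem_extChartAt_cotangent_source.1 ((extChartAt (cotangentModel E) α).map_target hz)
  have hβz : extChartAt (cotangentModel E) α β = z := (extChartAt (cotangentModel E) α).right_inv hz
  have h1 : extChartAt 𝓘(ℝ, E) α.proj β.proj = z.1 := by
    rw [← extChartAt_cotangent_fst, hβz]
  have h2 := extChartAt_cotangent_snd α β hβs
  rw [hβz, h1] at h2
  have hz1 : z.1 ∈ (extChartAt 𝓘(ℝ, E) α.proj).target := by
    rw [← h1]
    exact (extChartAt 𝓘(ℝ, E) α.proj).map_source (by rwa [extChartAt_source])
  have hev : (fun w => ((extChartAt (cotangentModel E) α).symm w).proj) =ᶠ[𝓝 z]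
      fun w : E × (E →L[ℝ] ℝ) => (extChartAt 𝓘(ℝ, E) α.proj).symm w.1 := by
    filter_upwards [(isOpen_extChartAt_target α).mem_nhds hz] with w hw
    have hs := (extChartAt (cotangentModel E) α).map_target hw
    have := extChartAt_cotangent_fst α ((extChartAt (cotangentModel E) α).symm w)
    rw [(extChartAt (cotangentModel E) α).right_inv hw] at this
    rw [this, (extChartAt 𝓘(ℝ, E) α.proj).left_inv]
    rw [extChartAt_source]
    exact mem_extChartAt_cotangent_source.1 hs
  -- The derivative of (q, p) ↦ q, followed by the inverse base chart, is computed in two ways; `h2`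
  -- then absorbs that chart derivative into the momentum.
  have hd1 := mfderiv_comp z (mdifferentiableAt_cotangent_proj β)
    (mdifferentiableAt_extChartAt_symm α hz)
  have hd2 := mfderiv_comp (I := 𝓘(ℝ, E × (E →L[ℝ] ℝ))) (I' := 𝓘(ℝ, E)) (I'' := 𝓘(ℝ, E)) z
    (f := Prod.fst) (mdifferentiableAt_extChartAt_symm (I := 𝓘(ℝ, E)) α.proj hz1)
    differentiableAt_fst.mdifferentiableAt
  have hd3 := hev.mfderiv_eq (I := 𝓘(ℝ, E × (E →L[ℝ] ℝ))) (I' := 𝓘(ℝ, E))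
  have hf : mfderiv 𝓘(ℝ, E × (E →L[ℝ] ℝ)) 𝓘(ℝ, E) (Prod.fst : E × (E →L[ℝ] ℝ) → E) z =
      ContinuousLinearMap.fst ℝ E (E →L[ℝ] ℝ) := by
    rw [mfderiv_eq_fderiv]; exact fderiv_fst
  rw [hf] at hd2
  refine ContinuousLinearMap.ext fun w => ?_
  have hw1 := congrArg (fun L : E × (E →L[ℝ] ℝ) →L[ℝ] E => L w) hd1
  have hw2 := congrArg (fun L : E × (E →L[ℝ] ℝ) →L[ℝ] E => L w) hd2
  have hw3 := congrArg (fun L : E × (E →L[ℝ] ℝ) →L[ℝ] E => L w) hd3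
  have key := (hw1.symm.trans hw3).trans hw2
  rw [h2]
  exact congrArg (fun u : E => (β.2 : E →L[ℝ] ℝ) u) key

/-- In a chart of `T^*Q`, `dθ = dp_A ∧ dq^A`. -/
lemma extDerivOneForm_liouvilleForm_apply (α : CotangentBundle E Q)
    (v w : TangentSpace (cotangentModel E) α) :
    extDerivOneForm (cotangentModel E) (liouvilleForm E Q) α v w =
      (mfderiv (cotangentModel E) 𝓘(ℝ, E × (E →L[ℝ] ℝ)) (extChartAt (cotangentModel E) α) α v :
          E × (E →L[ℝ] ℝ)).2
        (mfderiv (cotangentModel E) 𝓘(ℝ, E × (E →L[ℝ] ℝ)) (extChartAt (cotangentModel E) α) α w :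
          E × (E →L[ℝ] ℝ)).1 -
      (mfderiv (cotangentModel E) 𝓘(ℝ, E × (E →L[ℝ] ℝ)) (extChartAt (cotangentModel E) α) α w :
          E × (E →L[ℝ] ℝ)).2
        (mfderiv (cotangentModel E) 𝓘(ℝ, E × (E →L[ℝ] ℝ)) (extChartAt (cotangentModel E) α) α v :
          E × (E →L[ℝ] ℝ)).1 := by
  have hev : localOneForm (cotangentModel E) (liouvilleForm E Q) α
      =ᶠ[𝓝 (extChartAt (cotangentModel E) α α)]
      ⇑((ContinuousLinearMap.precomp ℝ (ContinuousLinearMap.fst ℝ E (E →L[ℝ] ℝ))).comp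
        (ContinuousLinearMap.snd ℝ E (E →L[ℝ] ℝ))) := by
    filter_upwards [extChartAt_target_mem_nhds (I := cotangentModel E) α] with z hz
    exact localOneForm_liouvilleForm α hz
  -- In these coordinates the form is linear in z, so it is its own derivative.
  have hD := hev.fderiv_eq.trans (ContinuousLinearMap.fderiv _)
  unfold extDerivOneForm
  rw [hD]
  rfl

end LiouvilleForm

/-! ### Vertical vectors, and graphs of one-forms. -/

section CanonicalForm

variable {E : Type*} [NormedAddCommGroup E] [NormedSpace ℝ E]
  {Q : Type*} [TopologicalSpace Q] [ChartedSpace E Q] [IsManifold 𝓘(ℝ, E) ∞ Q]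

lemma canonicalForm_apply (α : CotangentBundle E Q) (v w : TangentSpace (cotangentModel E) α) :
    canonicalForm E Q α v w =
      -extDerivOneForm (cotangentModel E) (liouvilleForm E Q) α v w :=
  rfl

lemma mfderiv_extChartAt_cotangent_fst (α : CotangentBundle E Q)
    (v : TangentSpace (cotangentModel E) α) :
    (mfderiv (cotangentModel E) 𝓘(ℝ, E × (E →L[ℝ] ℝ)) (extChartAt (cotangentModel E) α) α v :
      E × (E →L[ℝ] ℝ)).1 =
    mfderiv 𝓘(ℝ, E) 𝓘(ℝ, E) (extChartAt 𝓘(ℝ, E) α.proj) α.proj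
      (mfderiv (cotangentModel E) 𝓘(ℝ, E) (fun β : CotangentBundle E Q => β.proj) α v) := by
  have : IsManifold 𝓘(ℝ, E) 1 Q := .of_le (n := ∞) (by simp)
  have : IsManifold (cotangentModel E) 1 (CotangentBundle E Q) := .of_le (n := ∞) (by simp)
  have hfun : (Prod.fst ∘ extChartAt (cotangentModel E) α : CotangentBundle E Q → E) =
      extChartAt 𝓘(ℝ, E) α.proj ∘ fun β : CotangentBundle E Q => β.proj :=
    funext fun β => extChartAt_cotangent_fst α β
  have hd1 := mfderiv_comp (I := cotangentModel E) (I' := 𝓘(ℝ, E × (E →L[ℝ] ℝ)))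
    (I'' := 𝓘(ℝ, E)) α (g := Prod.fst) differentiableAt_fst.mdifferentiableAt
    (mdifferentiableAt_extChartAt (I := cotangentModel E) (mem_chart_source _ α))
  have hd2 := mfderiv_comp (I := cotangentModel E) (I' := 𝓘(ℝ, E)) (I'' := 𝓘(ℝ, E)) α
    (mdifferentiableAt_extChartAt (I := 𝓘(ℝ, E)) (mem_chart_source _ α.proj))
    (mdifferentiableAt_cotangent_proj α)
  rw [mfderiv_eq_fderiv, fderiv_fst, hfun] at hd1
  have hv1 := congrArg (fun L : E × (E →L[ℝ] ℝ) →L[ℝ] E => L v) hd1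
  have hv2 := congrArg (fun L : E × (E →L[ℝ] ℝ) →L[ℝ] E => L v) hd2
  exact hv1.symm.trans hv2

/-- The fibres of `T^*Q` are isotropic. -/
lemma canonicalForm_apply_of_vertical (α : CotangentBundle E Q)
    {v w : TangentSpace (cotangentModel E) α}
    (hv : mfderiv (cotangentModel E) 𝓘(ℝ, E) (fun β : CotangentBundle E Q => β.proj) α v = 0)
    (hw : mfderiv (cotangentModel E) 𝓘(ℝ, E) (fun β : CotangentBundle E Q => β.proj) α w = 0) :
    canonicalForm E Q α v w = 0 := by
  -- Each term of dp ∧ dq contains a position component, which is zero on a vertical vector.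
  rw [canonicalForm_apply, extDerivOneForm_liouvilleForm_apply, mfderiv_extChartAt_cotangent_fst,
    mfderiv_extChartAt_cotangent_fst, hv, hw, map_zero]
  erw [map_zero, map_zero]
  simp

lemma extChartAt_toCotangent (γ : OneForm 𝓘(ℝ, E) Q) {q x : Q} (hx : x ∈ (chartAt E q).source) :
    extChartAt (cotangentModel E) (toCotangent γ q) (toCotangent γ x) =
      (extChartAt 𝓘(ℝ, E) q x, localOneForm 𝓘(ℝ, E) γ q (extChartAt 𝓘(ℝ, E) q x)) := by
  refine Prod.ext (extChartAt_cotangent_fst _ _) ?_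
  rw [extChartAt_cotangent_snd _ _ hx]
  have hinv : (extChartAt 𝓘(ℝ, E) q).symm (extChartAt 𝓘(ℝ, E) q x) = x :=
    (extChartAt 𝓘(ℝ, E) q).left_inv (by rwa [extChartAt_source])
  exact congrArg (fun y : Q => ContinuousLinearMap.comp (γ y : E →L[ℝ] ℝ)
    (mfderiv 𝓘(ℝ, E) 𝓘(ℝ, E) (extChartAt 𝓘(ℝ, E) q).symm (extChartAt 𝓘(ℝ, E) q x) : E →L[ℝ] E))
    hinv.symm

/-- Regularity of γ is given as a map into T^*Q; its chart expression is the momentum component of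
that map read in charts. -/
lemma differentiableAt_localOneForm (γ : OneForm 𝓘(ℝ, E) Q) {q : Q}
    (hγ : MDifferentiableAt 𝓘(ℝ, E) (cotangentModel E) (toCotangent γ) q) :
    DifferentiableAt ℝ (localOneForm 𝓘(ℝ, E) γ q) (extChartAt 𝓘(ℝ, E) q q) := by
  have : IsManifold 𝓘(ℝ, E) 1 Q := .of_le (n := ∞) (by simp)
  have : IsManifold (cotangentModel E) 1 (CotangentBundle E Q) := .of_le (n := ∞) (by simp)
  have hq : (extChartAt 𝓘(ℝ, E) q).symm (extChartAt 𝓘(ℝ, E) q q) = q := extChartAt_to_inv q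
  have h1 : MDifferentiableAt 𝓘(ℝ, E) 𝓘(ℝ, E × (E →L[ℝ] ℝ))
      (extChartAt (cotangentModel E) (toCotangent γ q) ∘ toCotangent γ) q :=
    (mdifferentiableAt_extChartAt (I := cotangentModel E) (mem_chart_source _ _)).comp q hγ
  have h2 : MDifferentiableAt 𝓘(ℝ, E) 𝓘(ℝ, E × (E →L[ℝ] ℝ))
      ((extChartAt (cotangentModel E) (toCotangent γ q) ∘ toCotangent γ) ∘
        (extChartAt 𝓘(ℝ, E) q).symm) (extChartAt 𝓘(ℝ, E) q q) :=
    MDifferentiableAt.comp (I' := 𝓘(ℝ, E)) _ (by rwa [hq])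
      (mdifferentiableAt_extChartAt_symm q (mem_extChartAt_target q))
  have h3 := (mdifferentiableAt_iff_differentiableAt.1 h2).snd
  refine h3.congr_of_eventuallyEq ?_
  filter_upwards [extChartAt_target_mem_nhds (I := 𝓘(ℝ, E)) q] with y hy
  have hs := (extChartAt 𝓘(ℝ, E) q).map_target hy
  rw [extChartAt_source] at hs
  simp only [Function.comp_apply]
  rw [extChartAt_toCotangent γ hs, (extChartAt 𝓘(ℝ, E) q).right_inv hy]

/-- In charts γ is the graph map y ↦ (y, η(y)), whose derivative is (id, Dη). -/
lemma mfderiv_extChartAt_mfderiv_toCotangent (γ : OneForm 𝓘(ℝ, E) Q) {q : Q}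
    (hγ : MDifferentiableAt 𝓘(ℝ, E) (cotangentModel E) (toCotangent γ) q)
    (u : TangentSpace 𝓘(ℝ, E) q) :
    (mfderiv (cotangentModel E) 𝓘(ℝ, E × (E →L[ℝ] ℝ))
      (extChartAt (cotangentModel E) (toCotangent γ q)) (toCotangent γ q)
      (mfderiv 𝓘(ℝ, E) (cotangentModel E) (toCotangent γ) q u) : E × (E →L[ℝ] ℝ)) =
    ((mfderiv 𝓘(ℝ, E) 𝓘(ℝ, E) (extChartAt 𝓘(ℝ, E) q) q u : E),
      fderiv ℝ (localOneForm 𝓘(ℝ, E) γ q) (extChartAt 𝓘(ℝ, E) q q)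
        (mfderiv 𝓘(ℝ, E) 𝓘(ℝ, E) (extChartAt 𝓘(ℝ, E) q) q u : E)) := by
  have : IsManifold 𝓘(ℝ, E) 1 Q := .of_le (n := ∞) (by simp)
  have : IsManifold (cotangentModel E) 1 (CotangentBundle E Q) := .of_le (n := ∞) (by simp)
  have hd1 := mfderiv_comp q
    (mdifferentiableAt_extChartAt (I := cotangentModel E) (mem_chart_source _ (toCotangent γ q))) hγ
  have hg : HasFDerivAt (fun y => (y, localOneForm 𝓘(ℝ, E) γ q y))
      ((ContinuousLinearMap.id ℝ E).prod
        (fderiv ℝ (localOneForm 𝓘(ℝ, E) γ q) (extChartAt 𝓘(ℝ, E) q q)))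
      (extChartAt 𝓘(ℝ, E) q q) :=
    (hasFDerivAt_id _).prodMk (differentiableAt_localOneForm γ hγ).hasFDerivAt
  have hd2 := mfderiv_comp (I := 𝓘(ℝ, E)) (I' := 𝓘(ℝ, E)) (I'' := 𝓘(ℝ, E × (E →L[ℝ] ℝ))) q
    hg.differentiableAt.mdifferentiableAt
    (mdifferentiableAt_extChartAt (I := 𝓘(ℝ, E)) (mem_chart_source _ q))
  rw [mfderiv_eq_fderiv, hg.fderiv] at hd2
  have hev : (extChartAt (cotangentModel E) (toCotangent γ q) ∘ toCotangent γ) =ᶠ[𝓝 q]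
      ((fun y => (y, localOneForm 𝓘(ℝ, E) γ q y)) ∘ extChartAt 𝓘(ℝ, E) q) := by
    filter_upwards [(chartAt E q).open_source.mem_nhds (mem_chart_source E q)] with x hx
    exact extChartAt_toCotangent γ hx
  have hd3 := hev.mfderiv_eq (I := 𝓘(ℝ, E)) (I' := 𝓘(ℝ, E × (E →L[ℝ] ℝ)))
  have hu1 := congrArg (fun L : E →L[ℝ] E × (E →L[ℝ] ℝ) => L u) hd1
  have hu2 := congrArg (fun L : E →L[ℝ] E × (E →L[ℝ] ℝ) => L u) hd2
  have hu3 := congrArg (fun L : E →L[ℝ] E × (E →L[ℝ] ℝ) => L u) hd3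
  exact (hu1.symm.trans hu3).trans hu2

/-- The pullback of the canonical symplectic form by a one-form `γ` is `-dγ`. -/
lemma pullbackForm_toCotangent_canonicalForm (γ : OneForm 𝓘(ℝ, E) Q) {q : Q}
    (hγ : MDifferentiableAt 𝓘(ℝ, E) (cotangentModel E) (toCotangent γ) q)
    (u v : TangentSpace 𝓘(ℝ, E) q) :
    pullbackForm 𝓘(ℝ, E) (cotangentModel E) (toCotangent γ) (canonicalForm E Q) q u v =
      -extDerivOneForm 𝓘(ℝ, E) γ q u v := by
  change canonicalForm E Q (toCotangent γ q) (mfderiv 𝓘(ℝ, E) (cotangentModel E) (toCotangent γ) q u)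
    (mfderiv 𝓘(ℝ, E) (cotangentModel E) (toCotangent γ) q v) = _
  rw [canonicalForm_apply, extDerivOneForm_liouvilleForm_apply,
    mfderiv_extChartAt_mfderiv_toCotangent γ hγ, mfderiv_extChartAt_mfderiv_toCotangent γ hγ]
  rfl

end CanonicalForm

/-! ### Chain rules, and the linear algebra of a section. -/

section Pullback

variable {E₁ : Type*} [NormedAddCommGroup E₁] [NormedSpace ℝ E₁]
  {H₁ : Type*} [TopologicalSpace H₁] {I₁ : ModelWithCorners ℝ E₁ H₁}
  {M₁ : Type*} [TopologicalSpace M₁] [ChartedSpace H₁ M₁]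
  {E₂ : Type*} [NormedAddCommGroup E₂] [NormedSpace ℝ E₂]
  {H₂ : Type*} [TopologicalSpace H₂] {I₂ : ModelWithCorners ℝ E₂ H₂}
  {M₂ : Type*} [TopologicalSpace M₂] [ChartedSpace H₂ M₂]
  {E₃ : Type*} [NormedAddCommGroup E₃] [NormedSpace ℝ E₃]
  {H₃ : Type*} [TopologicalSpace H₃] {I₃ : ModelWithCorners ℝ E₃ H₃}
  {M₃ : Type*} [TopologicalSpace M₃] [ChartedSpace H₃ M₃]

lemma pullbackForm_comp {f : M₁ → M₂} {g : M₂ → M₃} (Ω : BilinForm I₃ M₃) {x : M₁}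
    (hg : MDifferentiableAt I₂ I₃ g (f x)) (hf : MDifferentiableAt I₁ I₂ f x) :
    pullbackForm I₁ I₃ (g ∘ f) Ω x = pullbackForm I₁ I₂ f (pullbackForm I₂ I₃ g Ω) x := by
  unfold pullbackForm
  rw [mfderiv_comp x hg hf]
  rfl

lemma mvfderiv_comp_apply {f : M₁ → M₂} {h : M₂ → ℝ} {x : M₁}
    (hh : MDifferentiableAt I₂ 𝓘(ℝ, ℝ) h (f x)) (hf : MDifferentiableAt I₁ I₂ f x)
    (v : TangentSpace I₁ x) :
    mvfderiv I₁ (fun y => h (f y)) x v = mvfderiv I₂ h (f x) (mfderiv I₁ I₂ f x v) := by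
  have := mfderiv_comp x hh hf
  exact congrArg (fun L : E₁ →L[ℝ] ℝ => L v) this

end Pullback

/-- Let `S` be a section of a linear map `P`, and let `B` be a bilinear form for which `ker P` and
the image of `S` are isotropic. Then `B (x - S P x)` is the composition of `P` with the
restriction of `B x` to the image of `S`. -/
lemma bilin_apply_sub_section {F G : Type*} [NormedAddCommGroup F] [NormedSpace ℝ F]
    [NormedAddCommGroup G] [NormedSpace ℝ G] (B : F →L[ℝ] F →L[ℝ] ℝ) (P : F →L[ℝ] G)
    (S : G →L[ℝ] F) (hPS : ∀ u, P (S u) = u) (hP : ∀ u v, P u = 0 → P v = 0 → B u v = 0)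
    (hS : ∀ u v, B (S u) (S v) = 0) (x w : F) :
    B (x - S (P x)) w = B x (S (P w)) := by
  -- Both arguments lie in ker P. Hence w may be replaced by S P w, after which isotropy of im S
  -- removes the term S P x.
  have h1 : B (x - S (P x)) (w - S (P w)) = 0 := hP _ _ (by simp [hPS]) (by simp [hPS])
  rw [map_sub, sub_eq_zero] at h1
  rw [h1, map_sub, sub_apply, hS, sub_zero]

/-! ### Smooth vector fields along a map. -/

section FieldsAlong

variable {F : Type*} [NormedAddCommGroup F] [NormedSpace ℝ F]
  {M : Type*} [TopologicalSpace M] [ChartedSpace F M] [IsManifold 𝓘(ℝ, F) ∞ M]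
  {G : Type*} [NormedAddCommGroup G] [NormedSpace ℝ G]
  {N : Type*} [TopologicalSpace N] [ChartedSpace G N]

/-- Smoothness is tested in the trivialization at `φ n`, which is fibrewise linear as long as φ
stays in its base set. -/
lemma IsSmoothFieldAlong.add {φ : N → M} {V W : (n : N) → TangentSpace 𝓘(ℝ, F) (φ n)}
    (hV : IsSmoothFieldAlong (G := G) φ V) (hW : IsSmoothFieldAlong (G := G) φ W) :
    IsSmoothFieldAlong (G := G) φ (fun n => V n + W n) := by
  intro n
  have h1 := Bundle.contMDiffAt_totalSpace.1 (hV n)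
  have h2 := Bundle.contMDiffAt_totalSpace.1 (hW n)
  refine Bundle.contMDiffAt_totalSpace.2 ⟨h1.1, (h1.2.add h2.2).congr_of_eventuallyEq ?_⟩
  have hb : ∀ᶠ k in 𝓝 n, φ k ∈ (trivializationAt F (TangentSpace 𝓘(ℝ, F)) (φ n)).baseSet :=
    h1.1.continuousAt ((trivializationAt F (TangentSpace 𝓘(ℝ, F)) (φ n)).open_baseSet.mem_nhds
      (FiberBundle.mem_baseSet_trivializationAt' (φ n)))
  filter_upwards [hb] with k hk
  have hL := (trivializationAt F (TangentSpace 𝓘(ℝ, F)) (φ n)).continuousLinearMapAt_apply_of_mem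
    ℝ hk
  exact (hL _).symm.trans ((map_add _ _ _).trans (congrArg₂ _ (hL _) (hL _)))

lemma IsSmoothFieldAlong.sub {φ : N → M} {V W : (n : N) → TangentSpace 𝓘(ℝ, F) (φ n)}
    (hV : IsSmoothFieldAlong (G := G) φ V) (hW : IsSmoothFieldAlong (G := G) φ W) :
    IsSmoothFieldAlong (G := G) φ (fun n => V n - W n) := by
  intro n
  have h1 := Bundle.contMDiffAt_totalSpace.1 (hV n)
  have h2 := Bundle.contMDiffAt_totalSpace.1 (hW n)
  refine Bundle.contMDiffAt_totalSpace.2 ⟨h1.1, (h1.2.sub h2.2).congr_of_eventuallyEq ?_⟩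
  have hb : ∀ᶠ k in 𝓝 n, φ k ∈ (trivializationAt F (TangentSpace 𝓘(ℝ, F)) (φ n)).baseSet :=
    h1.1.continuousAt ((trivializationAt F (TangentSpace 𝓘(ℝ, F)) (φ n)).open_baseSet.mem_nhds
      (FiberBundle.mem_baseSet_trivializationAt' (φ n)))
  filter_upwards [hb] with k hk
  have hL := (trivializationAt F (TangentSpace 𝓘(ℝ, F)) (φ n)).continuousLinearMapAt_apply_of_mem
    ℝ hk
  exact (hL _).symm.trans ((map_sub _ _ _).trans (congrArg₂ _ (hL _) (hL _)))

lemma IsSmoothFieldAlong.comp {K : Type*} [NormedAddCommGroup K] [NormedSpace ℝ K]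
    {L : Type*} [TopologicalSpace L] [ChartedSpace K L]
    {φ : N → M} {V : (n : N) → TangentSpace 𝓘(ℝ, F) (φ n)}
    (hV : IsSmoothFieldAlong (G := G) φ V) {ψ : L → N} (hψ : ContMDiff 𝓘(ℝ, K) 𝓘(ℝ, G) ∞ ψ) :
    IsSmoothFieldAlong (G := K) (fun l => φ (ψ l)) (fun l => V (ψ l)) :=
  ContMDiff.comp hV hψ

end FieldsAlong

end SingularHJ

/-! ### The Hamilton–Jacobi theorem. -/

theorem mainTheorem3
    -- the configuration manifold `Q`
    {E : Type*} [NormedAddCommGroup E] [NormedSpace ℝ E] [FiniteDimensional ℝ E]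
    {Q : Type*} [TopologicalSpace Q] [ChartedSpace E Q] [IsManifold 𝓘(ℝ, E) ∞ Q]
    -- the submanifold `j₁ : M₁ → T^*Q`, with the constrained hamiltonian `h₁`
    {F₁ : Type*} [NormedAddCommGroup F₁] [NormedSpace ℝ F₁] [FiniteDimensional ℝ F₁]
    {M₁ : Type*} [TopologicalSpace M₁] [ChartedSpace F₁ M₁] [IsManifold 𝓘(ℝ, F₁) ∞ M₁]
    (j₁ : M₁ → SingularHJ.CotangentBundle E Q)
    (hj₁ : Manifold.IsSmoothEmbedding 𝓘(ℝ, F₁) (SingularHJ.cotangentModel E) ∞ j₁)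
    (h₁ : M₁ → ℝ) (hh₁ : ContMDiff 𝓘(ℝ, F₁) 𝓘(ℝ, ℝ) ∞ h₁)
    -- the presymplectic form `ω₁ = j₁^* ω_Q`
    (ω₁ : SingularHJ.BilinForm 𝓘(ℝ, F₁) M₁)
    (hω₁ : ω₁ = SingularHJ.pullbackForm 𝓘(ℝ, F₁) (SingularHJ.cotangentModel E) j₁
      (SingularHJ.canonicalForm E Q))
    -- the final constraint submanifold `jf : Mf → M₁`
    {F : Type*} [NormedAddCommGroup F] [NormedSpace ℝ F] [FiniteDimensional ℝ F]
    {Mf : Type*} [TopologicalSpace Mf] [ChartedSpace F Mf] [IsManifold 𝓘(ℝ, F) ∞ Mf]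
    (jf : Mf → M₁) (hjf : Manifold.IsSmoothEmbedding 𝓘(ℝ, F) 𝓘(ℝ, F₁) ∞ jf)
    (hfinal : SingularHJ.IsFinalConstraintSubmanifold ω₁ h₁ (Set.range jf))
    -- the submanifold `Qf = π_Q(Mf)` of `Q`, with inclusion `ιf`
    {G : Type*} [NormedAddCommGroup G] [NormedSpace ℝ G] [FiniteDimensional ℝ G]
    {Qf : Type*} [TopologicalSpace Qf] [ChartedSpace G Qf] [IsManifold 𝓘(ℝ, G) ∞ Qf]
    (ιf : Qf → Q) (hιf : Manifold.IsSmoothEmbedding 𝓘(ℝ, G) 𝓘(ℝ, E) ∞ ιf)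
    (hQf : Set.range ιf = Set.range (fun m : Mf => (j₁ (jf m)).proj))
    -- the restriction `πf : Mf → Qf` of `π_Q`, a surjective submersion
    (πf : Mf → Qf) (hπf : ∀ m, ιf (πf m) = (j₁ (jf m)).proj)
    (hπf_sub : Manifold.IsSubmersion 𝓘(ℝ, F) 𝓘(ℝ, G) ∞ πf)
    -- the closed one-form `γ` with image in `M₁`
    (γ : SingularHJ.OneForm 𝓘(ℝ, E) Q)
    (hγ : ContMDiff 𝓘(ℝ, E) (SingularHJ.cotangentModel E) ∞ (SingularHJ.toCotangent γ))
    (hγ_closed : ∀ q, SingularHJ.extDerivOneForm 𝓘(ℝ, E) γ q = 0)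
    (hγ_im : Set.range (SingularHJ.toCotangent γ) ⊆ Set.range j₁)
    -- its restriction `γf : Qf → Mf` to `Qf`, with image in `Mf`
    (γf : Qf → Mf) (hγf : ∀ q, j₁ (jf (γf q)) = SingularHJ.toCotangent γ (ιf q))
    -- a solution `X` of the extended equations of motion on `Mf`
    (X : (m : Mf) → TangentSpace 𝓘(ℝ, F) m)
    (hX : SingularHJ.IsExtendedSolution ω₁ h₁ jf X)
    -- the vector field `X^γ = Tπf ∘ X ∘ γf` on `Qf`
    (Xγ : (q : Qf) → TangentSpace 𝓘(ℝ, G) q)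
    (hXγ : ∀ q, (⟨q, Xγ q⟩ : TangentBundle 𝓘(ℝ, G) Qf) =
      tangentMap 𝓘(ℝ, F) 𝓘(ℝ, G) πf ⟨γf q, X (γf q)⟩) :
    ((∀ q, SingularHJ.pullbackForm 𝓘(ℝ, F) 𝓘(ℝ, F₁) jf ω₁ (γf q)
        (X (γf q) - mfderiv 𝓘(ℝ, G) 𝓘(ℝ, F) γf q (Xγ q)) = 0) ↔
      (∀ q, mvfderiv 𝓘(ℝ, G) (fun q' => h₁ (jf (γf q'))) q = 0)) ∧
    ((∀ q, mvfderiv 𝓘(ℝ, G) (fun q' => h₁ (jf (γf q'))) q = 0) →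
      SingularHJ.IsExtendedSolutionAlong (G := G) ω₁ h₁ jf γf
        (fun q => mfderiv 𝓘(ℝ, G) 𝓘(ℝ, F) γf q (Xγ q))) := by
  have : IsManifold 𝓘(ℝ, E) 1 Q := .of_le (n := ∞) (by simp)
  have hj₁d := fun m => hj₁.contMDiff.mdifferentiableAt (x := m) (by simp)
  have hjfd := fun m => hjf.contMDiff.mdifferentiableAt (x := m) (by simp)
  have hιfd := fun q => hιf.contMDiff.mdifferentiableAt (x := q) (by simp)
  have hπfd := fun m => hπf_sub.contMDiff.mdifferentiableAt (x := m) (by simp)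
  have hγd := fun q => hγ.mdifferentiableAt (x := q) (by simp)
  have hh₁d := fun m => hh₁.mdifferentiableAt (x := m) (by simp)
  -- `γf` is a smooth section of `πf`
  have hγf_eq : (j₁ ∘ jf) ∘ γf = SingularHJ.toCotangent γ ∘ ιf := funext hγf
  have hγf_smooth : ContMDiff 𝓘(ℝ, G) 𝓘(ℝ, F) ∞ γf := by
    have h : ContMDiff 𝓘(ℝ, G) (SingularHJ.cotangentModel E) ∞ ((j₁ ∘ jf) ∘ γf) :=
      hγf_eq ▸ hγ.comp hιf.contMDiff
    -- Continuity comes from the topological embedding; smoothness then lifts through the two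
    -- immersions in turn.
    have hc : Continuous γf :=
      (hj₁.isEmbedding.comp hjf.isEmbedding).continuous_iff.2 h.continuous
    exact (ContMDiff.iff_comp_isImmersion hjf.isImmersion).2 ⟨hc,
      (ContMDiff.iff_comp_isImmersion hj₁.isImmersion).2 ⟨hjf.contMDiff.continuous.comp hc, h⟩⟩
  have hγfd := fun q => hγf_smooth.mdifferentiableAt (x := q) (by simp)
  have hsec : ∀ q, πf (γf q) = q := fun q => hιf.isEmbedding.injective <| by
    rw [hπf, hγf]; rfl
  have hPS : ∀ q (w : G), (mfderiv 𝓘(ℝ, F) 𝓘(ℝ, G) πf (γf q)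
      (mfderiv 𝓘(ℝ, G) 𝓘(ℝ, F) γf q w) : G) = w := fun q w => by
    have h1 := mfderiv_comp q (hπfd (γf q)) (hγfd q)
    rw [show πf ∘ γf = id from funext hsec, mfderiv_id] at h1
    exact (congrArg (fun L : G →L[ℝ] G => L w) h1).symm
  have hXγ' : ∀ q, (Xγ q : G) = mfderiv 𝓘(ℝ, F) 𝓘(ℝ, G) πf (γf q) (X (γf q)) := fun q =>
    eq_of_heq (Bundle.TotalSpace.mk.inj (hXγ q)).2
  -- the form `ωf` on `Mf`
  have hωf : ∀ m, SingularHJ.pullbackForm 𝓘(ℝ, F) 𝓘(ℝ, F₁) jf ω₁ m =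
      SingularHJ.pullbackForm 𝓘(ℝ, F) (SingularHJ.cotangentModel E) (j₁ ∘ jf)
        (SingularHJ.canonicalForm E Q) m := fun m => by
    rw [hω₁, SingularHJ.pullbackForm_comp _ (hj₁d _) (hjfd _)]
  have hvert : ∀ m (u v : F), (mfderiv 𝓘(ℝ, F) 𝓘(ℝ, G) πf m u : G) = 0 →
      (mfderiv 𝓘(ℝ, F) 𝓘(ℝ, G) πf m v : G) = 0 →
      SingularHJ.pullbackForm 𝓘(ℝ, F) 𝓘(ℝ, F₁) jf ω₁ m u v = 0 := fun m u v hu hv => by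
    -- Differentiating ι_f ∘ π_f = π_Q ∘ j₁ ∘ j_f shows that ker Tπ_f is sent to vertical vectors.
    have h1 := mfderiv_comp m (SingularHJ.mdifferentiableAt_cotangent_proj (j₁ (jf m)))
      ((hj₁d (jf m)).comp m (hjfd m))
    have h2 := mfderiv_comp m (hιfd (πf m)) (hπfd m)
    rw [show ιf ∘ πf = (fun β : SingularHJ.CotangentBundle E Q => β.proj) ∘ (j₁ ∘ jf) from
      funext hπf] at h2
    have hproj : ∀ w : F, (mfderiv 𝓘(ℝ, F) 𝓘(ℝ, G) πf m w : G) = 0 →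
        mfderiv (SingularHJ.cotangentModel E) 𝓘(ℝ, E)
          (fun β : SingularHJ.CotangentBundle E Q => β.proj) (j₁ (jf m))
          (mfderiv 𝓘(ℝ, F) (SingularHJ.cotangentModel E) (j₁ ∘ jf) m w) = 0 := fun w hw => by
      have h3 := (congrArg (fun L : F →L[ℝ] E => L w) h1).symm.trans
        (congrArg (fun L : F →L[ℝ] E => L w) h2)
      refine h3.trans ?_
      refine (congrArg (mfderiv 𝓘(ℝ, G) 𝓘(ℝ, E) ιf (πf m)) hw).trans ?_
      exact map_zero _
    rw [hωf]
    exact SingularHJ.canonicalForm_apply_of_vertical _ (hproj u hu) (hproj v hv)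
  have hisot : ∀ q (u v : G), SingularHJ.pullbackForm 𝓘(ℝ, F) 𝓘(ℝ, F₁) jf ω₁ (γf q)
      (mfderiv 𝓘(ℝ, G) 𝓘(ℝ, F) γf q u) (mfderiv 𝓘(ℝ, G) 𝓘(ℝ, F) γf q v) = 0 := fun q u v => by
    rw [hωf]
    -- Since j₁ ∘ j_f ∘ γ_f = γ ∘ ι_f, the pullback γ_f^*ω_f equals ι_f^*(-dγ).
    have h1 := SingularHJ.pullbackForm_comp (SingularHJ.canonicalForm E Q)
      ((hj₁d _).comp _ (hjfd (γf q))) (hγfd q)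
    rw [hγf_eq, SingularHJ.pullbackForm_comp _ (hγd _) (hιfd q)] at h1
    refine (congrArg (fun L : G →L[ℝ] G →L[ℝ] ℝ => L u v) h1).symm.trans ?_
    refine (SingularHJ.pullbackForm_toCotangent_canonicalForm γ (hγd (ιf q)) _ _).trans ?_
    rw [hγ_closed]
    exact neg_zero
  obtain ⟨Y, Z, hY, hZ, hXYZ, hYeq, hZker⟩ := hX
  have hYω : ∀ m (w : F), SingularHJ.pullbackForm 𝓘(ℝ, F) 𝓘(ℝ, F₁) jf ω₁ m (Y m) w =
      mvfderiv 𝓘(ℝ, F₁) h₁ (jf m) (mfderiv 𝓘(ℝ, F) 𝓘(ℝ, F₁) jf m w) := fun m w =>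
    congrArg (fun L : F₁ →L[ℝ] ℝ => L (mfderiv 𝓘(ℝ, F) 𝓘(ℝ, F₁) jf m w)) (hYeq m)
  have hXω : ∀ m, SingularHJ.pullbackForm 𝓘(ℝ, F) 𝓘(ℝ, F₁) jf ω₁ m (X m) =
      SingularHJ.pullbackForm 𝓘(ℝ, F) 𝓘(ℝ, F₁) jf ω₁ m (Y m) := fun m => by
    rw [hXYZ, map_add, hZker m, add_zero]
  have hdh : ∀ q (w : G), mvfderiv 𝓘(ℝ, G) (fun q' => h₁ (jf (γf q'))) q w =
      mvfderiv 𝓘(ℝ, F₁) h₁ (jf (γf q)) (mfderiv 𝓘(ℝ, F) 𝓘(ℝ, F₁) jf (γf q)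
        (mfderiv 𝓘(ℝ, G) 𝓘(ℝ, F) γf q w)) := fun q w =>
    (SingularHJ.mvfderiv_comp_apply (f := γf) (h := fun m => h₁ (jf m))
      ((hh₁d _).comp (γf q) (hjfd _)) (hγfd q) w).trans
      (SingularHJ.mvfderiv_comp_apply (hh₁d _) (hjfd _) _)
  have key : ∀ q (w : F), SingularHJ.pullbackForm 𝓘(ℝ, F) 𝓘(ℝ, F₁) jf ω₁ (γf q)
      (X (γf q) - mfderiv 𝓘(ℝ, G) 𝓘(ℝ, F) γf q (Xγ q)) w =
      mvfderiv 𝓘(ℝ, G) (fun q' => h₁ (jf (γf q'))) q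
        (mfderiv 𝓘(ℝ, F) 𝓘(ℝ, G) πf (γf q) w : G) := fun q w => by
    have h1 := SingularHJ.bilin_apply_sub_section (F := F) (G := G)
      (SingularHJ.pullbackForm 𝓘(ℝ, F) 𝓘(ℝ, F₁) jf ω₁ (γf q) : F →L[ℝ] F →L[ℝ] ℝ)
      (mfderiv 𝓘(ℝ, F) 𝓘(ℝ, G) πf (γf q) : F →L[ℝ] G) (mfderiv 𝓘(ℝ, G) 𝓘(ℝ, F) γf q : G →L[ℝ] F)
      (hPS q) (hvert (γf q)) (hisot q) (X (γf q)) w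
    have h2 := congrArg (fun u : G => (SingularHJ.pullbackForm 𝓘(ℝ, F) 𝓘(ℝ, F₁) jf ω₁ (γf q) :
      F →L[ℝ] F →L[ℝ] ℝ) ((X (γf q) : F) - (mfderiv 𝓘(ℝ, G) 𝓘(ℝ, F) γf q : G →L[ℝ] F) u) w) (hXγ' q)
    have h3 := congrArg (fun L : F →L[ℝ] ℝ => L (mfderiv 𝓘(ℝ, G) 𝓘(ℝ, F) γf q
      (mfderiv 𝓘(ℝ, F) 𝓘(ℝ, G) πf (γf q) w : G))) (hXω (γf q))
    exact h2.trans (h1.trans (h3.trans ((hYω _ _).trans (hdh _ _).symm)))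
  have hforward : (∀ q, mvfderiv 𝓘(ℝ, G) (fun q' => h₁ (jf (γf q'))) q = 0) →
      ∀ q, SingularHJ.pullbackForm 𝓘(ℝ, F) 𝓘(ℝ, F₁) jf ω₁ (γf q)
        (X (γf q) - mfderiv 𝓘(ℝ, G) 𝓘(ℝ, F) γf q (Xγ q)) = 0 := fun h q =>
    ContinuousLinearMap.ext fun w =>
      (key q w).trans (congrArg (fun L : G →L[ℝ] ℝ =>
        L (mfderiv 𝓘(ℝ, F) 𝓘(ℝ, G) πf (γf q) w : G)) (h q))
  refine ⟨⟨fun h q => ContinuousLinearMap.ext fun w => ?_, hforward⟩, fun h => ?_⟩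
  · have h1 := key q (mfderiv 𝓘(ℝ, G) 𝓘(ℝ, F) γf q w)
    rw [h q, hPS q w] at h1
    exact h1.symm
  · have hX_smooth : ContMDiff 𝓘(ℝ, F) 𝓘(ℝ, F).tangent ∞
        (fun m => (⟨m, X m⟩ : TangentBundle 𝓘(ℝ, F) Mf)) := hY.add hZ |>.congr fun m => by rw [hXYZ m]
    have hV : SingularHJ.IsSmoothFieldAlong (G := G) γf
        (fun q => mfderiv 𝓘(ℝ, G) 𝓘(ℝ, F) γf q (Xγ q)) := by
      -- The field is the composite Tγ_f ∘ Tπ_f ∘ X ∘ γ_f of smooth maps.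
      have h1 := (hγf_smooth.contMDiff_tangentMap (m := ∞) (by simp)).comp
        ((hπf_sub.contMDiff.contMDiff_tangentMap (m := ∞) (by simp)).comp
          (hX_smooth.comp hγf_smooth))
      refine h1.congr fun q => ?_
      simp only [Function.comp_apply]
      rw [← hXγ q]
      rfl
    -- Y is kept, and the remainder Tγ_f(X^γ) - Y must lie in ker ω_f: ω_f takes the same value on
    -- Tγ_f(X^γ) as on X, hence as on Y.
    refine ⟨fun q => Y (γf q), fun q => mfderiv 𝓘(ℝ, G) 𝓘(ℝ, F) γf q (Xγ q) - Y (γf q),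
      SingularHJ.IsSmoothFieldAlong.comp hY hγf_smooth,
      hV.sub (SingularHJ.IsSmoothFieldAlong.comp hY hγf_smooth), fun q => by simp,
      fun q => hYeq (γf q), fun q => ?_⟩
    have h1 := hforward h q
    rw [map_sub, hXω, sub_eq_zero] at h1
    rw [map_sub, ← h1, sub_self]
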